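/- Let $k$ be a field, $t\ge 0$ an integer and $0=m_0\le m_1\le\dots\le m_t$ integers, so that $E=(x^t,x^{t-1}y^{m_1},\dots,xy^{m_{t-1}},y^{m_t})\subset k[x,y]$ is a monomial ideal of finite colength (every such ideal has this form). Put $d_i=m_i-m_{i-1}$ for $1\le i\le t$. Let $k[\mathbf a]$ be the polynomial ring in variables $a_{i,j,l}$, where $1\le i\le t+1$, $1\le j\le t$, and $0\le l<d_j$ if $i>j$, $0\le l<d_i$ if $i\le j$. Let $B=\operatorname{Spec} k[\mathbf a]$ and $a_{i,j}=\sum_l a_{i,j,l}\,y^l$. Let $\mathcal M$ be the $(t+1)\times t$ matrix over $k[\mathbf a][x,y]$ whose $(i,j)$ entry is $a_{i,j}+y^{d_j}$ if $i=j$, $a_{i,j}-x$ if $i=j+1$, and $a_{i,j}$ otherwise. Let $I_t(\mathcal M)$ be the ideal generated by its maximal minors and let $$\pi\colon V(I_t(\mathcal M))\hookrightarrow \mathbb A^2\times B\longrightarrow B$$ be the composition of the inclusion and the projection. Let $\mathrm{res}_E\in k[\mathbf a][y]$ be the resultant, with respect to $x$, of the determinants of $\mathcal M$ with the first row removed and with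 the last row removed. Let $B'\subset B$ be the open complement of the common vanishing locus of all coefficients of $\mathrm{res}_E$ as a polynomial in $y$. Let $S$ be the subscheme of $B$ on which $\mathrm{res}_E$ has degree exactly $t\,m_t$ in $y$, that is, the intersection of the closed subscheme defined by the coefficients of $y^n$ in $\mathrm{res}_E$ for all $n>t\,m_t$ with the open subscheme on which the coefficient of $y^{t m_t}$ is invertible. Then $S$ is a locally closed subscheme of $B'$, and the restriction $V(I_t(\mathcal M))\times_B S\to S$ of $\pi$ to $S$ is finite and flat. -/

import Mathlib

open AlgebraicGeometry CategoryTheory CategoryTheory.Limits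

-- Instance search on `Polynomial (Polynomial (MvPolynomial σ k))` needs a larger nesting depth.
set_option maxSynthPendingDepth 5

universe u

noncomputable section

namespace HilbertBurch

/-! A monomial ideal of finite colength is given by the exponents `0 = m 0 ≤ m 1 ≤ ... ≤ m t` in
`E = (x ^ t, x ^ (t - 1) * y ^ (m 1), ..., x * y ^ (m (t - 1)), y ^ (m t))`. Rows of the matrices
below are indexed by `Fin (t + 1)` and columns by `Fin t`, so indices start at `0`. -/

/-- The steps `d_j = m_j - m_{j-1}` (`j = 1, ..., t`), indexed from `0`. -/
def step {t : ℕ} (m : Fin (t + 1) → ℕ) (j : Fin t) : ℕ :=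
  m j.succ - m j.castSucc

/-- The strict bound on the `y`-degree of the entry `a_{i,j}`: it is `d_j` if `i > j` and `d_i` if
`i ≤ j`. -/
def bound {t : ℕ} (m : Fin (t + 1) → ℕ) (i : Fin (t + 1)) (j : Fin t) : ℕ :=
  if h : j.castSucc < i then step m j
  else step m (i.castLT (lt_of_le_of_lt (Fin.le_def.mp (not_lt.mp h)) j.isLt))

/-- The index set of the parameters `a_{i,j,l}`: triples with `l < bound m i j`. -/
abbrev Param {t : ℕ} (m : Fin (t + 1) → ℕ) : Type :=
  Σ i : Fin (t + 1), Σ j : Fin t, Fin (bound m i j)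

variable (k : Type u) [Field k] {t : ℕ} (m : Fin (t + 1) → ℕ)

/-- The polynomial ring `k[a]` in all parameters `a_{i,j,l}`. -/
abbrev ParamRing : Type u := MvPolynomial (Param m) k

/-- The ring `k[a][y][x]`: the outer variable is `x`, the inner one is `y`. -/
abbrev TotalRing : Type u := Polynomial (Polynomial (ParamRing k m))

/-- The variable `x`. -/
def xVar : TotalRing k m := Polynomial.X

/-- The variable `y`. -/
def yVar : TotalRing k m := Polynomial.C Polynomial.X

/-- The universal entry `a_{i,j} = ∑ l, a_{i,j,l} * y ^ l`, with `l < bound m i j`. -/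
def entry (i : Fin (t + 1)) (j : Fin t) : TotalRing k m :=
  ∑ l : Fin (bound m i j),
    Polynomial.C (Polynomial.C (MvPolynomial.X (⟨i, j, l⟩ : Param m))) * yVar k m ^ (l : ℕ)

/-- The Hilbert-Burch matrix `M_E` of the monomial ideal `E`: it has `y ^ d_j` at `(j, j)`, `-x` at
`(j + 1, j)`, and zeros elsewhere. -/
def monomialMatrix : Matrix (Fin (t + 1)) (Fin t) (TotalRing k m) :=
  Matrix.of fun i j =>
    if i = j.castSucc then yVar k m ^ step m j else if i = j.succ then -xVar k m else 0

/-- The spread out matrix, `M_E + (a_{i,j})`. -/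
def spreadMatrix : Matrix (Fin (t + 1)) (Fin t) (TotalRing k m) :=
  monomialMatrix k m + Matrix.of (entry k m)

/-- The `i`-th maximal minor of the spread out matrix: the determinant without the `i`-th row. -/
def minor (i : Fin (t + 1)) : TotalRing k m :=
  ((spreadMatrix k m).submatrix i.succAbove id).det

/-- The ideal of maximal minors of the spread out matrix. -/
def minorIdeal : Ideal (TotalRing k m) :=
  Ideal.span (Set.range (minor k m))

/-- The base `B = Spec k[a]`. -/
abbrev base : Scheme.{u} := Spec (CommRingCat.of (ParamRing k m))

/-- The product `𝔸² × B = Spec k[a][y][x]`. -/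
abbrev plane : Scheme.{u} := Spec (CommRingCat.of (TotalRing k m))

/-- The projection `𝔸² × B ⟶ B`. -/
def planeToBase : plane k m ⟶ base k m :=
  Spec.map (CommRingCat.ofHom
    ((Polynomial.C : Polynomial (ParamRing k m) →+* TotalRing k m).comp Polynomial.C))

/-- The closed subscheme of `𝔸² × B` cut out by the maximal minors. -/
abbrev incidence : Scheme.{u} := Spec (CommRingCat.of (TotalRing k m ⧸ minorIdeal k m))

/-- The closed immersion of the incidence scheme into `𝔸² × B`. -/
def incidenceToPlane : incidence k m ⟶ plane k m :=
  Spec.map (CommRingCat.ofHom (Ideal.Quotient.mk (minorIdeal k m)))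

/-- The family `π`. -/
def family : incidence k m ⟶ base k m :=
  incidenceToPlane k m ≫ planeToBase k m

/-- The resultant with respect to `x` of the first and the last maximal minor, in `k[a][y]`. -/
def res : Polynomial (ParamRing k m) :=
  Polynomial.resultant (minor k m 0) (minor k m (Fin.last t))

/-- The open subscheme `B'` of `B`: the complement of the common vanishing locus of all coefficients
of the resultant as a polynomial in `y`. -/
def baseOpen : (base k m).Opens :=
  ⟨(PrimeSpectrum.zeroLocus (Set.range (res k m).coeff))ᶜ,
    (PrimeSpectrum.isClosed_zeroLocus _).isOpen_compl⟩

/-- The expected degree `t * m_t` of the resultant. -/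
def expectedDegree : ℕ := t * m (Fin.last t)

/-- The ideal generated by the coefficients of the resultant at `y ^ n` for `n > t * m_t`. -/
def higherCoeffIdeal : Ideal (ParamRing k m) :=
  Ideal.span {c | ∃ n, expectedDegree m < n ∧ c = (res k m).coeff n}

/-- The coordinate ring of `S`: the coefficients of the resultant in degrees above `t * m_t` are set
to zero, and the one in degree `t * m_t` is inverted. -/
abbrev StratumRing : Type u :=
  Localization.Away (Ideal.Quotient.mk (higherCoeffIdeal k m)
    ((res k m).coeff (expectedDegree m)))

/-- The subscheme `S` where the resultant has degree exactly `t * m_t` in `y`: the intersection of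
the closed subscheme where the higher coefficients vanish with the open subscheme where the
coefficient of `y ^ (t * m_t)` is invertible. -/
abbrev stratum : Scheme.{u} := Spec (CommRingCat.of (StratumRing k m))

/-- The inclusion `S ⟶ B`. -/
def stratumToBase : stratum k m ⟶ base k m :=
  Spec.map (CommRingCat.ofHom
    ((algebraMap (ParamRing k m ⧸ higherCoeffIdeal k m) (StratumRing k m)).comp
      (Ideal.Quotient.mk (higherCoeffIdeal k m))))

/-- The restriction of the family `π` to `S`. -/
def familyOnStratum : pullback (family k m) (stratumToBase k m) ⟶ stratum k m :=
  pullback.snd (family k m) (stratumToBase k m)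

end HilbertBurch

end

/-! Deleting row `0` of the spread out matrix leaves, up to sign, the characteristic matrix (in `x`)
of a matrix over `k[a][y]`, so the minor `Δ₀` is `±1` times a monic polynomial in `x`. Over `S` the
resultant `r(y) ∈ I_t(M)` also has unit leading coefficient. The quotient of `T[y][x]` by `Δ₀` and
`r` is therefore finite over the coordinate ring `T` of `S`, hence so is the family. Moreover,
modulo any ideal `J` of `T`, the pair `Δ₀, r` is still a regular sequence in `I_t(M)`, so the
Hilbert–Burch complex stays exact; lifting relations then gives
`I_t(M) ∩ J T[y][x] = J I_t(M)`, which is flatness of the quotient. -/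

namespace HilbertBurch

open Matrix Polynomial

section Minors

variable {A B : Type*} [CommRing A] [CommRing B] {t : ℕ}

/-- The maximal minor of a `(t + 1) × t` matrix obtained by deleting the `i`-th row. -/
noncomputable def maximalMinor (M : Matrix (Fin (t + 1)) (Fin t) A) (i : Fin (t + 1)) : A :=
  (M.submatrix i.succAbove id).det

/-- The ideal `I_t(M)` of maximal minors of a `(t + 1) × t` matrix. -/
noncomputable def maximalMinorIdeal (M : Matrix (Fin (t + 1)) (Fin t) A) : Ideal A :=
  Ideal.span (Set.range (maximalMinor M))

/-- The row of maximal minors with alternating signs, that is, the second map of the Hilbert–Burch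
complex `A ^ t → A ^ (t + 1) → A`. -/
noncomputable def signedMinor (M : Matrix (Fin (t + 1)) (Fin t) A) (i : Fin (t + 1)) : A :=
  (-1) ^ (i : ℕ) * maximalMinor M i

theorem maximalMinor_mem (M : Matrix (Fin (t + 1)) (Fin t) A) (i : Fin (t + 1)) :
    maximalMinor M i ∈ maximalMinorIdeal M :=
  Ideal.subset_span ⟨i, rfl⟩

theorem mem_maximalMinorIdeal_iff {M : Matrix (Fin (t + 1)) (Fin t) A} {a : A} :
    a ∈ maximalMinorIdeal M ↔ ∃ w, signedMinor M ⬝ᵥ w = a := by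
  rw [maximalMinorIdeal, Ideal.mem_span_range_iff_exists_fun]
  have sign_sq (i : Fin (t + 1)) : ((-1) ^ (i : ℕ) * (-1) ^ (i : ℕ) : A) = 1 := by
    rw [← mul_pow, neg_one_mul, neg_neg, one_pow]
  constructor
  · rintro ⟨c, rfl⟩
    refine ⟨fun i ↦ (-1) ^ (i : ℕ) * c i, Finset.sum_congr rfl fun i _ ↦ ?_⟩
    rw [signedMinor]
    linear_combination (c i * maximalMinor M i) * sign_sq i
  · rintro ⟨w, rfl⟩
    refine ⟨fun i ↦ (-1) ^ (i : ℕ) * w i, Finset.sum_congr rfl fun i _ ↦ ?_⟩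
    rw [signedMinor]
    ring

theorem maximalMinor_map (g : A →+* B) (M : Matrix (Fin (t + 1)) (Fin t) A) (i : Fin (t + 1)) :
    maximalMinor (M.map g) i = g (maximalMinor M i) := by
  rw [maximalMinor, maximalMinor, g.map_det]
  rfl

theorem signedMinor_map (g : A →+* B) (M : Matrix (Fin (t + 1)) (Fin t) A) :
    signedMinor (M.map g) = g ∘ signedMinor M := by
  funext i
  simp [signedMinor, maximalMinor_map]

theorem maximalMinorIdeal_map (g : A →+* B) (M : Matrix (Fin (t + 1)) (Fin t) A) :
    maximalMinorIdeal (M.map g) = (maximalMinorIdeal M).map g := by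
  rw [maximalMinorIdeal, maximalMinorIdeal, Ideal.map_span, ← Set.range_comp]
  exact congrArg (fun v ↦ Ideal.span (Set.range v)) (funext (maximalMinor_map g M))

theorem signedMinor_vecMul (M : Matrix (Fin (t + 1)) (Fin t) A) : signedMinor M ᵥ* M = 0 := by
  funext j
  -- Laplace expansion along the repeated column.
  let N : Matrix (Fin (t + 1)) (Fin (t + 1)) A := of fun i ↦ Fin.cons (M i j) (M i)
  have det_eq_zero : N.det = 0 := det_zero_of_column_eq (Fin.succ_ne_zero j).symm fun _ ↦ rfl
  rw [Pi.zero_apply, ← det_eq_zero, det_succ_column_zero]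
  change ∑ i, signedMinor M i * M i j = _
  refine Finset.sum_congr rfl fun i _ ↦ ?_
  rw [signedMinor, mul_right_comm]
  rfl

theorem signedMinor_dotProduct_mulVec (M : Matrix (Fin (t + 1)) (Fin t) A) (u : Fin t → A) :
    signedMinor M ⬝ᵥ M *ᵥ u = 0 := by
  rw [dotProduct_mulVec, signedMinor_vecMul, zero_dotProduct]

/-- Cramer's rule for the rows other than `p`; row `p` follows because the discrepancy is a
syzygy of the minors. -/
theorem exists_mulVec_eq_maximalMinor_smul {M : Matrix (Fin (t + 1)) (Fin t) A} {p : Fin (t + 1)}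
    (hp : maximalMinor M p ∈ nonZeroDivisors A) {w : Fin (t + 1) → A}
    (hw : signedMinor M ⬝ᵥ w = 0) : ∃ u, M *ᵥ u = maximalMinor M p • w := by
  let N := M.submatrix p.succAbove id
  let u := N.adjugate *ᵥ (w ∘ p.succAbove)
  have eq_off_p (j : Fin t) :
      (M *ᵥ u) (p.succAbove j) = (maximalMinor M p • w) (p.succAbove j) := by
    have : N *ᵥ u = maximalMinor M p • (w ∘ p.succAbove) := by
      rw [mulVec_mulVec, mul_adjugate, smul_mulVec, one_mulVec]
      rfl
    exact congrFun this j
  have syzygy : signedMinor M ⬝ᵥ (M *ᵥ u - maximalMinor M p • w) = 0 := by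
    rw [dotProduct_sub, signedMinor_dotProduct_mulVec, dotProduct_smul, hw, smul_zero, sub_zero]
  have eq_at_p : (M *ᵥ u) p = (maximalMinor M p • w) p := by
    rw [dotProduct, Fin.sum_univ_succAbove _ p, Finset.sum_eq_zero fun j _ ↦ by
      rw [Pi.sub_apply, eq_off_p, sub_self, mul_zero], add_zero, signedMinor, mul_assoc,
      (isUnit_neg_one.pow _).mul_right_eq_zero] at syzygy
    exact sub_eq_zero.mp (hp.1 _ syzygy)
  exact ⟨u, funext <| p.forall_iff_succAbove.mpr ⟨eq_at_p, eq_off_p⟩⟩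

theorem dvd_mul_of_dvd_mulVec {M : Matrix (Fin (t + 1)) (Fin t) A} {f h : A} {u : Fin t → A}
    (hu : ∀ i, f ∣ (M *ᵥ u) i) (hh : h ∈ maximalMinorIdeal M) (j : Fin t) : f ∣ h * u j := by
  have dvd_minor (i : Fin (t + 1)) : f ∣ maximalMinor M i * u j := by
    let N := M.submatrix i.succAbove id
    have : N.adjugate *ᵥ (N *ᵥ u) = maximalMinor M i • u := by
      rw [mulVec_mulVec, adjugate_mul, smul_mulVec, one_mulVec]
      rfl
    rw [← smul_eq_mul, ← Pi.smul_apply, ← this]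
    have dvd_term (l : Fin t) : f ∣ N.adjugate j l * (N *ᵥ u) l :=
      (hu (i.succAbove l)).mul_left _
    change f ∣ ∑ l, N.adjugate j l * (N *ᵥ u) l
    exact Finset.dvd_sum fun l _ ↦ dvd_term l
  obtain ⟨w, rfl⟩ := mem_maximalMinorIdeal_iff.mp hh
  rw [dotProduct, Finset.sum_mul]
  refine Finset.dvd_sum fun i _ ↦ ?_
  rw [signedMinor, mul_right_comm, mul_assoc _ _ (u j), mul_right_comm]
  exact (dvd_minor i).mul_left _

/-- Exactness of the Hilbert–Burch complex at `A ^ (t + 1)`. -/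
theorem exists_mulVec_eq_of_signedMinor_dotProduct_eq_zero
    {M : Matrix (Fin (t + 1)) (Fin t) A} {p : Fin (t + 1)}
    (hp : maximalMinor M p ∈ nonZeroDivisors A) {h : A} (hh : h ∈ maximalMinorIdeal M)
    (hreg : ∀ a, maximalMinor M p ∣ h * a → maximalMinor M p ∣ a)
    {w : Fin (t + 1) → A} (hw : signedMinor M ⬝ᵥ w = 0) : ∃ u, M *ᵥ u = w := by
  obtain ⟨u, hu⟩ := exists_mulVec_eq_maximalMinor_smul hp hw
  have dvd_u (j : Fin t) : maximalMinor M p ∣ u j :=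
    hreg _ <| dvd_mul_of_dvd_mulVec (fun i ↦ ⟨w i, congrFun hu i⟩) hh j
  choose v hv using dvd_u
  obtain rfl : u = maximalMinor M p • v := funext hv
  rw [mulVec_smul] at hu
  exact ⟨v, funext fun i ↦ (mul_cancel_left_mem_nonZeroDivisors hp).mp (congrFun hu i)⟩

/-- Lifting relations along `g`: an element of the ideal that `g` kills gives a relation among the
minors over `B`, which exactness writes as a combination of columns. -/
theorem maximalMinorIdeal_inf_ker_le {g : A →+* B} (hg : Function.Surjective g)
    {M : Matrix (Fin (t + 1)) (Fin t) A}
    (hM : ∀ w, signedMinor (M.map g) ⬝ᵥ w = 0 → ∃ u, M.map g *ᵥ u = w) :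
    maximalMinorIdeal M ⊓ RingHom.ker g ≤ RingHom.ker g * maximalMinorIdeal M := by
  rintro a ⟨ha, hga⟩
  obtain ⟨w, rfl⟩ := mem_maximalMinorIdeal_iff.mp ha
  obtain ⟨u', hu'⟩ := hM (g ∘ w) (by rw [signedMinor_map, ← g.map_dotProduct]; exact hga)
  obtain ⟨u, rfl⟩ : ∃ u, g ∘ u = u' := hg.comp_left u'
  have sub_mem_ker (i : Fin (t + 1)) : (w - M *ᵥ u) i ∈ RingHom.ker g := by
    rw [RingHom.mem_ker, Pi.sub_apply, map_sub, g.map_mulVec, hu', Function.comp_apply, sub_self]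
  have : signedMinor M ⬝ᵥ w = (w - M *ᵥ u) ⬝ᵥ signedMinor M := by
    rw [dotProduct_comm, sub_dotProduct, dotProduct_comm (M *ᵥ u), signedMinor_dotProduct_mulVec,
      sub_zero]
  rw [this]
  exact Ideal.sum_mem _ fun i _ ↦ Ideal.mul_mem_mul (sub_mem_ker i)
    (Ideal.mul_mem_left _ _ (maximalMinor_mem M i))

end Minors

section Flatness

open TensorProduct

/-- The criterion `Tor₁(R ⧸ J, N) = 0` for a quotient `N` of a flat module `M`. -/
theorem flat_of_ker_inf_smul_top_le {R M N : Type*} [CommRing R] [AddCommGroup M] [Module R M]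
    [AddCommGroup N] [Module R N] [Module.Flat R M] {f : M →ₗ[R] N} (hf : Function.Surjective f)
    (h : ∀ J : Ideal R, LinearMap.ker f ⊓ J • ⊤ ≤ J • LinearMap.ker f) : Module.Flat R N := by
  rw [Module.Flat.iff_lift_lsmul_comp_subtype_injective]
  intro J hJ
  rw [injective_iff_map_eq_zero]
  intro x hx
  obtain ⟨z, rfl⟩ := LinearMap.lTensor_surjective J hf x
  let act := TensorProduct.lift ((LinearMap.lsmul R M).comp J.subtype)
  have f_act (z : J ⊗[R] M) :
      TensorProduct.lift ((LinearMap.lsmul R N).comp J.subtype) (f.lTensor J z) = f (act z) := by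
    induction z with
    | zero => simp only [map_zero]
    | tmul a m => exact (map_smul f (a : R) m).symm
    | add z z' hz hz' => simp only [map_add, hz, hz']
  have act_mem (z : J ⊗[R] M) : act z ∈ J • (⊤ : Submodule R M) := by
    induction z with
    | zero => simp only [map_zero, zero_mem]
    | tmul a m => exact Submodule.smul_mem_smul a.2 trivial
    | add z z' hz hz' => simpa only [map_add] using add_mem hz hz'
  have smul_ker_le :
      J • LinearMap.ker f ≤ LinearMap.range (act ∘ₗ (LinearMap.ker f).subtype.lTensor J) :=
    Submodule.smul_le.mpr fun a ha n hn ↦ ⟨⟨a, ha⟩ ⊗ₜ ⟨n, hn⟩, rfl⟩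
  obtain ⟨z', hz'⟩ := smul_ker_le (h J ⟨(f_act z).symm.trans hx, act_mem z⟩)
  obtain rfl : (LinearMap.ker f).subtype.lTensor J z' = z :=
    Module.Flat.iff_lift_lsmul_comp_subtype_injective.mp ‹_› hJ hz'
  rw [← LinearMap.comp_apply, ← LinearMap.lTensor_comp, LinearMap.comp_ker_subtype,
    LinearMap.lTensor_zero, LinearMap.zero_apply]

variable {T A : Type*} [CommRing T] [CommRing A] [Algebra T A]

theorem flat_quotient_of_inf_map_le [Module.Flat T A] {I : Ideal A}
    (h : ∀ J : Ideal T, I ⊓ J.map (algebraMap T A) ≤ J.map (algebraMap T A) * I) :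
    Module.Flat T (A ⧸ I) := by
  refine flat_of_ker_inf_smul_top_le (f := (Ideal.Quotient.mkₐ T I).toLinearMap)
    Ideal.Quotient.mk_surjective fun J a ha ↦ ?_
  have ker_eq : LinearMap.ker (Ideal.Quotient.mkₐ T I).toLinearMap = I.restrictScalars T := by
    ext a
    exact Ideal.Quotient.eq_zero_iff_mem
  rw [ker_eq] at ha ⊢
  rw [Ideal.smul_top_eq_map] at ha
  rw [← Ideal.smul_restrictScalars]
  exact h J ha

end Flatness

section Bivariate

variable {R T : Type*} [CommRing R] [CommRing T] {t : ℕ}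

theorem exists_monic_associated {f : R[X]} (hf : IsUnit f.leadingCoeff) :
    ∃ g : R[X], g.Monic ∧ Associated f g := by
  refine ⟨_, monic_of_isUnit_leadingCoeff_inv_smul hf, Units.map C.toMonoidHom hf.unit⁻¹, ?_⟩
  rw [mul_comm, Units.smul_def, smul_eq_C_mul]
  rfl

theorem dvd_of_dvd_C_mul {f a : R[X]} (hf : IsUnit f.leadingCoeff) {h : R}
    (hh : h ∈ nonZeroDivisors R) (hdvd : f ∣ C h * a) : f ∣ a := by
  obtain ⟨g, hg, hfg⟩ := exists_monic_associated hf
  rw [hfg.dvd_iff_dvd_left, ← modByMonic_eq_zero_iff_dvd hg] at hdvd ⊢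
  rw [← smul_eq_C_mul, smul_modByMonic] at hdvd
  ext n
  exact hh.1 _ (by rw [← smul_eq_mul, ← coeff_smul, hdvd, coeff_zero])

theorem isUnit_leadingCoeff_map (g : R →+* T) {f : R[X]} (hf : IsUnit f.leadingCoeff) :
    IsUnit (f.map g).leadingCoeff := by
  nontriviality T
  rw [leadingCoeff_map_eq_of_isUnit_leadingCoeff g hf]
  exact hf.map g

theorem isUnit_leadingCoeff_maximalMinor_map (g : R →+* T) {M : Matrix (Fin (t + 1)) (Fin t) R[X]}
    {p : Fin (t + 1)} (hp : IsUnit (maximalMinor M p).leadingCoeff) :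
    IsUnit (maximalMinor (M.map (mapRingHom g)) p).leadingCoeff := by
  rw [maximalMinor_map]
  exact isUnit_leadingCoeff_map g hp

theorem C_map_mem_maximalMinorIdeal_map (g : R →+* T) {M : Matrix (Fin (t + 1)) (Fin t) R[X]}
    {h : R} (hM : C h ∈ maximalMinorIdeal M) :
    C (g h) ∈ maximalMinorIdeal (M.map (mapRingHom g)) := by
  rw [maximalMinorIdeal_map]
  simpa only [coe_mapRingHom, map_C] using Ideal.mem_map_of_mem (mapRingHom g) hM

theorem exists_mulVec_eq_of_C_mem {M : Matrix (Fin (t + 1)) (Fin t) R[X]} {p : Fin (t + 1)}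
    (hp : IsUnit (maximalMinor M p).leadingCoeff) {h : R} (hh : h ∈ nonZeroDivisors R)
    (hM : C h ∈ maximalMinorIdeal M) {w : Fin (t + 1) → R[X]} (hw : signedMinor M ⬝ᵥ w = 0) :
    ∃ u, M *ᵥ u = w :=
  exists_mulVec_eq_of_signedMinor_dotProduct_eq_zero
    (mem_nonZeroDivisors_of_leadingCoeff hp.mem_nonZeroDivisors) hM
    (fun _ ↦ dvd_of_dvd_C_mul hp hh) hw

theorem ker_mapRingHom_mapRingHom_mk (J : Ideal T) :
    RingHom.ker (mapRingHom (mapRingHom (Ideal.Quotient.mk J))) =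
      J.map (algebraMap T T[X][X]) := by
  rw [ker_mapRingHom, ker_mapRingHom, Ideal.mk_ker, Ideal.map_map]
  rfl

theorem flat_quotient_maximalMinorIdeal {M : Matrix (Fin (t + 1)) (Fin t) T[X][X]}
    {p : Fin (t + 1)} (hp : IsUnit (maximalMinor M p).leadingCoeff) {h : T[X]}
    (hh : IsUnit h.leadingCoeff) (hM : C h ∈ maximalMinorIdeal M) :
    Module.Flat T (T[X][X] ⧸ maximalMinorIdeal M) := by
  have : Module.Free T T[X][X] := .trans (S := T[X])
  refine flat_quotient_of_inf_map_le fun J ↦ ?_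
  let φ := mapRingHom (mapRingHom (Ideal.Quotient.mk J))
  have surjective_φ : Function.Surjective φ :=
    map_surjective _ (map_surjective _ Ideal.Quotient.mk_surjective)
  rw [← ker_mapRingHom_mapRingHom_mk]
  have isUnit_h_mod : IsUnit (h.map (Ideal.Quotient.mk J)).leadingCoeff :=
    isUnit_leadingCoeff_map _ hh
  exact maximalMinorIdeal_inf_ker_le surjective_φ fun w ↦
    exists_mulVec_eq_of_C_mem (isUnit_leadingCoeff_maximalMinor_map _ hp)
      (mem_nonZeroDivisors_of_leadingCoeff isUnit_h_mod.mem_nonZeroDivisors)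
      (C_map_mem_maximalMinorIdeal_map _ hM)

theorem finite_mk_comp_C {I : Ideal R[X]} {f : R[X]} (hf : IsUnit f.leadingCoeff) (hI : f ∈ I) :
    ((Ideal.Quotient.mk I).comp C).Finite := by
  obtain ⟨g, hg, hfg⟩ := exists_monic_associated hf
  have span_le : Ideal.span {g} ≤ I :=
    (Ideal.span_singleton_le_iff_mem I).mpr (I.mem_of_dvd hfg.dvd hI)
  have finite_span : (algebraMap R (R[X] ⧸ Ideal.span {g})).Finite :=
    RingHom.finite_algebraMap.mpr hg.finite_quotient
  exact (RingHom.Finite.of_surjective _ (Ideal.Quotient.factor_surjective span_le)).comp finite_span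

theorem finite_mk_comp_C_comp_C {I : Ideal R[X][X]} {f : R[X][X]} (hf : IsUnit f.leadingCoeff)
    (hfI : f ∈ I) {h : R[X]} (hh : IsUnit h.leadingCoeff) (hhI : C h ∈ I) :
    ((Ideal.Quotient.mk I).comp (C.comp C)).Finite := by
  have finite_comap : ((Ideal.Quotient.mk (I.comap C)).comp C).Finite :=
    finite_mk_comp_C hh hhI
  have finite_quotientMap : (Ideal.quotientMap I C le_rfl).Finite := by
    refine RingHom.Finite.of_comp_finite (f := Ideal.Quotient.mk (I.comap C)) ?_
    rw [Ideal.quotientMap_comp_mk]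
    exact finite_mk_comp_C hf hfI
  exact finite_quotientMap.comp finite_comap

theorem C_resultant_mem_maximalMinorIdeal {M : Matrix (Fin (t + 1)) (Fin t) R[X]}
    {p : Fin (t + 1)} (hp : IsUnit (maximalMinor M p).leadingCoeff) (q : Fin (t + 1)) :
    C (resultant (maximalMinor M p) (maximalMinor M q)) ∈ maximalMinorIdeal M := by
  by_cases hdeg : (maximalMinor M p).natDegree = 0
  · have isUnit_minor : IsUnit (maximalMinor M p) := by
      rw [eq_C_of_natDegree_eq_zero hdeg, isUnit_C]
      rwa [leadingCoeff, hdeg] at hp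
    rw [Ideal.eq_top_of_isUnit_mem _ (maximalMinor_mem M p) isUnit_minor]
    trivial
  · obtain ⟨a, b, -, -, hab⟩ := exists_mul_add_mul_eq_C_resultant
      (maximalMinor M p) (maximalMinor M q) le_rfl le_rfl (.inl hdeg)
    rw [← hab]
    exact add_mem (Ideal.mul_mem_right _ _ (maximalMinor_mem M p))
      (Ideal.mul_mem_right _ _ (maximalMinor_mem M q))

end Bivariate

section BaseChange

variable {R T : Type u} [CommRing R] [CommRing T]

theorem isPushout_C (g : R →+* T) :
    IsPushout (CommRingCat.ofHom (C : R →+* R[X])) (CommRingCat.ofHom g)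
      (CommRingCat.ofHom (mapRingHom g)) (CommRingCat.ofHom C) := by
  algebraize [g, mapRingHom g]
  exact CommRingCat.isPushout_of_isPushout R R[X] T T[X]

attribute [local instance] Algebra.TensorProduct.rightAlgebra in
theorem isPushout_quotientMk (g : R →+* T) (I : Ideal R) :
    IsPushout (CommRingCat.ofHom (Ideal.Quotient.mk I)) (CommRingCat.ofHom g)
      (CommRingCat.ofHom (Ideal.quotientMap (I.map g) g Ideal.le_comap_map))
      (CommRingCat.ofHom (Ideal.Quotient.mk (I.map g))) := by
  algebraize [g]
  have : Algebra.IsPushout R (R ⧸ I) T (T ⧸ I.map (algebraMap R T)) :=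
    .of_equiv (Algebra.TensorProduct.quotIdealMapEquivQuotTensor T I).symm <|
      RingHom.ext fun b ↦ (Algebra.TensorProduct.quotIdealMapEquivQuotTensor T I).symm_apply_apply
        (Ideal.Quotient.mk _ b)
  exact CommRingCat.isPushout_of_isPushout R (R ⧸ I) T (T ⧸ I.map (algebraMap R T))

theorem isPushout_mk_comp_C_comp_C (g : R →+* T) (I : Ideal R[X][X]) :
    IsPushout (CommRingCat.ofHom ((Ideal.Quotient.mk I).comp (C.comp C))) (CommRingCat.ofHom g)
      (CommRingCat.ofHom (Ideal.quotientMap (I.map (mapRingHom (mapRingHom g)))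
        (mapRingHom (mapRingHom g)) Ideal.le_comap_map))
      (CommRingCat.ofHom
        ((Ideal.Quotient.mk (I.map (mapRingHom (mapRingHom g)))).comp (C.comp C))) :=
  ((isPushout_C g).paste_horiz (isPushout_C (mapRingHom g))).paste_horiz
    (isPushout_quotientMk (mapRingHom (mapRingHom g)) I)

/-- The family over `Spec R` cut out in the relative affine plane by an ideal of `R[y][x]`. -/
noncomputable def planeFamily (I : Ideal R[X][X]) :
    Spec (CommRingCat.of (R[X][X] ⧸ I)) ⟶ Spec (CommRingCat.of R) :=
  Spec.map (CommRingCat.ofHom (Ideal.Quotient.mk I)) ≫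
    Spec.map (CommRingCat.ofHom ((C : R[X] →+* R[X][X]).comp C))

theorem planeFamily_eq (I : Ideal R[X][X]) : planeFamily I =
    Spec.map (CommRingCat.ofHom ((Ideal.Quotient.mk I).comp (C.comp C))) := by
  rw [planeFamily, ← Spec.map_comp]
  rfl

theorem isPullback_planeFamily (g : R →+* T) (I : Ideal R[X][X]) :
    IsPullback
      (Spec.map (CommRingCat.ofHom (Ideal.quotientMap (I.map (mapRingHom (mapRingHom g)))
        (mapRingHom (mapRingHom g)) Ideal.le_comap_map)))
      (planeFamily (I.map (mapRingHom (mapRingHom g))))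
      (planeFamily I) (Spec.map (CommRingCat.ofHom g)) := by
  rw [planeFamily_eq, planeFamily_eq]
  exact isPullback_SpecMap_of_isPushout _ _ _ _ (isPushout_mk_comp_C_comp_C g I)

theorem pullback_snd_planeFamily {P : MorphismProperty Scheme.{u}} [P.RespectsIso]
    {g : R →+* T} {I : Ideal R[X][X]}
    (h : P (planeFamily (I.map (mapRingHom (mapRingHom g))))) :
    P (pullback.snd (planeFamily I) (Spec.map (CommRingCat.ofHom g))) := by
  rw [← (isPullback_planeFamily g I).isoPullback_inv_snd]
  exact (P.cancel_left_of_respectsIso _ _).mpr h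

end BaseChange

section ExactDegree

variable {R : Type u} [CommRing R] (r : R[X]) (d : ℕ)

/-- The ideal of the closed locus where `r` has degree at most `d`. -/
def coeffIdealAbove : Ideal R :=
  Ideal.span {c | ∃ n, d < n ∧ c = r.coeff n}

/-- The coordinate ring of the locally closed locus of `Spec R` where `r` has degree exactly `d`. -/
abbrev ExactDegreeRing : Type u :=
  Localization.Away (Ideal.Quotient.mk (coeffIdealAbove r d) (r.coeff d))

/-- The restriction of functions from `Spec R` to the locus where `r` has degree exactly `d`. -/
noncomputable def toExactDegreeRing : R →+* ExactDegreeRing r d :=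
  (algebraMap (R ⧸ coeffIdealAbove r d) (ExactDegreeRing r d)).comp
    (Ideal.Quotient.mk (coeffIdealAbove r d))

/-- The inclusion into `Spec R` of the locus where `r` has degree exactly `d`. -/
noncomputable def exactDegreeInclusion :
    Spec (CommRingCat.of (ExactDegreeRing r d)) ⟶ Spec (CommRingCat.of R) :=
  Spec.map (CommRingCat.ofHom (toExactDegreeRing r d))

/-- The open locus of `Spec R` where `r` is not the zero polynomial. -/
def nonvanishingLocus : (Spec (CommRingCat.of R)).Opens :=
  ⟨(PrimeSpectrum.zeroLocus (Set.range r.coeff))ᶜ,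
    (PrimeSpectrum.isClosed_zeroLocus _).isOpen_compl⟩

theorem isUnit_toExactDegreeRing_coeff : IsUnit (toExactDegreeRing r d (r.coeff d)) :=
  IsLocalization.Away.algebraMap_isUnit (Ideal.Quotient.mk (coeffIdealAbove r d) (r.coeff d))

variable {d} in
theorem toExactDegreeRing_coeff_of_lt {n : ℕ} (hn : d < n) :
    toExactDegreeRing r d (r.coeff n) = 0 := by
  have : Ideal.Quotient.mk (coeffIdealAbove r d) (r.coeff n) = 0 :=
    Ideal.Quotient.eq_zero_iff_mem.mpr (Ideal.subset_span ⟨n, hn, rfl⟩)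
  rw [toExactDegreeRing, RingHom.comp_apply, this, map_zero]

theorem isUnit_leadingCoeff_map_toExactDegreeRing :
    IsUnit (r.map (toExactDegreeRing r d)).leadingCoeff := by
  nontriviality ExactDegreeRing r d
  have isUnit_coeff : IsUnit ((r.map (toExactDegreeRing r d)).coeff d) := by
    rw [coeff_map]
    exact isUnit_toExactDegreeRing_coeff r d
  have natDegree_eq : (r.map (toExactDegreeRing r d)).natDegree = d := by
    refine natDegree_eq_of_le_of_coeff_ne_zero ?_ isUnit_coeff.ne_zero
    refine natDegree_le_iff_coeff_eq_zero.mpr fun n hn ↦ ?_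
    rw [coeff_map, toExactDegreeRing_coeff_of_lt r hn]
  rwa [leadingCoeff, natDegree_eq]

instance isImmersion_exactDegreeInclusion : IsImmersion (exactDegreeInclusion r d) := by
  have : IsOpenImmersion (Spec.map (CommRingCat.ofHom
      (algebraMap (R ⧸ coeffIdealAbove r d) (ExactDegreeRing r d)))) :=
    IsOpenImmersion.of_isLocalization (Ideal.Quotient.mk (coeffIdealAbove r d) (r.coeff d))
  have : IsClosedImmersion (Spec.map (CommRingCat.ofHom
      (Ideal.Quotient.mk (coeffIdealAbove r d)))) :=
    IsClosedImmersion.spec_of_surjective _ Ideal.Quotient.mk_surjective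
  rw [exactDegreeInclusion, toExactDegreeRing, CommRingCat.ofHom_comp, Spec.map_comp]
  infer_instance

theorem range_exactDegreeInclusion_subset :
    Set.range (exactDegreeInclusion r d) ⊆ Set.range (nonvanishingLocus r).ι := by
  rintro _ ⟨x, rfl⟩
  rw [Scheme.Opens.range_ι]
  intro vanishes
  have coeff_mem : r.coeff d ∈ (exactDegreeInclusion r d x).asIdeal := vanishes ⟨d, rfl⟩
  exact x.isPrime.ne_top <|
    Ideal.eq_top_of_isUnit_mem _ coeff_mem (isUnit_toExactDegreeRing_coeff r d)

theorem exists_isImmersion_nonvanishingLocus :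
    ∃ j : Spec (CommRingCat.of (ExactDegreeRing r d)) ⟶ (nonvanishingLocus r).toScheme,
      IsImmersion j ∧ j ≫ (nonvanishingLocus r).ι = exactDegreeInclusion r d := by
  have lift_fac := IsOpenImmersion.lift_fac (nonvanishingLocus r).ι (exactDegreeInclusion r d)
    (range_exactDegreeInclusion_subset r d)
  have : IsImmersion (IsOpenImmersion.lift _ _ (range_exactDegreeInclusion_subset r d) ≫
      (nonvanishingLocus r).ι) := by
    rw [lift_fac]
    infer_instance
  exact ⟨_, .of_comp _ (nonvanishingLocus r).ι, lift_fac⟩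

end ExactDegree

section Family

variable {R T : Type u} [CommRing R] [CommRing T] {t : ℕ}
  {M : Matrix (Fin (t + 1)) (Fin t) R[X][X]} {p : Fin (t + 1)} {g : R →+* T}

theorem isFinite_planeFamily (hp : IsUnit (maximalMinor M p).leadingCoeff) {h : R[X]}
    (hh : IsUnit h.leadingCoeff) (hM : C h ∈ maximalMinorIdeal M) :
    IsFinite (planeFamily (maximalMinorIdeal M)) := by
  rw [planeFamily_eq, IsFinite.SpecMap_iff]
  exact finite_mk_comp_C_comp_C hp (maximalMinor_mem M p) hh hM

theorem flat_planeFamily (hp : IsUnit (maximalMinor M p).leadingCoeff) {h : R[X]}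
    (hh : IsUnit h.leadingCoeff) (hM : C h ∈ maximalMinorIdeal M) :
    Flat (planeFamily (maximalMinorIdeal M)) := by
  have := flat_quotient_maximalMinorIdeal hp hh hM
  rw [planeFamily_eq, Flat.SpecMap_iff]
  exact RingHom.flat_algebraMap_iff.mpr this

theorem isFinite_and_flat_pullback_snd_planeFamily
    (hp : IsUnit (maximalMinor M p).leadingCoeff) {h : R[X]}
    (hh : IsUnit (h.map g).leadingCoeff) (hM : C h ∈ maximalMinorIdeal M) :
    IsFinite (pullback.snd (planeFamily (maximalMinorIdeal M)) (Spec.map (CommRingCat.ofHom g))) ∧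
      Flat (pullback.snd (planeFamily (maximalMinorIdeal M))
        (Spec.map (CommRingCat.ofHom g))) := by
  have := MorphismProperty.IsStableUnderBaseChange.respectsIso (P := @IsFinite.{u})
  have := MorphismProperty.IsStableUnderBaseChange.respectsIso (P := @Flat.{u})
  refine ⟨pullback_snd_planeFamily (P := @IsFinite) ?_, pullback_snd_planeFamily (P := @Flat) ?_⟩
  all_goals rw [← maximalMinorIdeal_map]
  · exact isFinite_planeFamily (isUnit_leadingCoeff_maximalMinor_map _ hp) hh
      (C_map_mem_maximalMinorIdeal_map _ hM)
  · exact flat_planeFamily (isUnit_leadingCoeff_maximalMinor_map _ hp) hh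
      (C_map_mem_maximalMinorIdeal_map _ hM)

end Family

section Universal

variable (k : Type u) [Field k] {t : ℕ} (m : Fin (t + 1) → ℕ)

theorem exists_submatrix_spreadMatrix_eq_neg_charmatrix :
    ∃ N : Matrix (Fin t) (Fin t) (ParamRing k m)[X],
      (spreadMatrix k m).submatrix Fin.succ id = -N.charmatrix := by
  refine ⟨of fun i j ↦ (if i.succ = j.castSucc then X ^ step m j else 0) +
    ∑ l : Fin (bound m i.succ j), C (MvPolynomial.X ⟨i.succ, j, l⟩) * X ^ (l : ℕ), ?_⟩
  ext1 i j
  rcases eq_or_ne i j with rfl | hij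
  · simp [spreadMatrix, monomialMatrix, entry, xVar, yVar, charmatrix_apply_eq,
      i.castSucc_lt_succ.ne', add_comm, sub_eq_add_neg]
  · simp [spreadMatrix, monomialMatrix, entry, yVar, hij, apply_ite C]

theorem isUnit_leadingCoeff_maximalMinor_spreadMatrix_zero :
    IsUnit (maximalMinor (spreadMatrix k m) 0).leadingCoeff := by
  obtain ⟨N, hN⟩ := exists_submatrix_spreadMatrix_eq_neg_charmatrix k m
  have minor_eq : maximalMinor (spreadMatrix k m) 0 = C ((-1) ^ t) * N.charpoly := by
    rw [maximalMinor, Fin.succAbove_zero, hN, det_neg, Fintype.card_fin, charpoly, C_pow, C_neg,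
      C_1]
  have isUnit_sign : IsUnit ((-1) ^ t : (ParamRing k m)[X]) := isUnit_neg_one.pow t
  rwa [minor_eq, N.charpoly_monic.leadingCoeff_C_mul]

end Universal

end HilbertBurch

open HilbertBurch Polynomial in
theorem corollary6p3_general {R : Type u} [CommRing R] {t : ℕ}
    (M : Matrix (Fin (t + 1)) (Fin t) R[X][X]) (p q : Fin (t + 1))
    (hp : IsUnit (maximalMinor M p).leadingCoeff) (d : ℕ) :
    let r := resultant (maximalMinor M p) (maximalMinor M q)
    let familyOnExactDegree :=
      pullback.snd (planeFamily (maximalMinorIdeal M)) (exactDegreeInclusion r d)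
    (∃ j : Spec (CommRingCat.of (ExactDegreeRing r d)) ⟶ (nonvanishingLocus r).toScheme,
      IsImmersion j ∧ j ≫ (nonvanishingLocus r).ι = exactDegreeInclusion r d) ∧
    IsFinite familyOnExactDegree ∧ Flat familyOnExactDegree :=
  ⟨exists_isImmersion_nonvanishingLocus _ d, isFinite_and_flat_pullback_snd_planeFamily hp
    (isUnit_leadingCoeff_map_toExactDegreeRing _ d) (C_resultant_mem_maximalMinorIdeal hp q)⟩

theorem corollary6p3 (k : Type u) [Field k] (t : ℕ) (m : Fin (t + 1) → ℕ)
    (hm0 : m 0 = 0) (hm : Monotone m) :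
    (∃ j : HilbertBurch.stratum k m ⟶ (HilbertBurch.baseOpen k m).toScheme,
      IsImmersion j ∧ j ≫ (HilbertBurch.baseOpen k m).ι = HilbertBurch.stratumToBase k m) ∧
    IsFinite (HilbertBurch.familyOnStratum k m) ∧
    Flat (HilbertBurch.familyOnStratum k m) :=
  corollary6p3_general (HilbertBurch.spreadMatrix k m) 0 (Fin.last t)
    (HilbertBurch.isUnit_leadingCoeff_maximalMinor_spreadMatrix_zero k m)
    (HilbertBurch.expectedDegree m)
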